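/- Let $K$ be a field and let $S$ be a numerical monoid, i.e. a submonoid of $(\mathbb N_0,+)$ with finite complement, and let $\mathsf f(S)=\max(\mathbb N_0\setminus S)$ be its Frobenius number (with $\mathsf f(S)=0$ if $S=\mathbb N_0$). Let $K[S]$ be the monoid algebra of $S$ over $K$. For a domain $D$ with quotient field $F$ and a fractional ideal $I$ of $D$, put $I^{-1}=\{x\in F : xI\subseteq D\}$ and $I_v=(I^{-1})^{-1}$; $I$ is a fractional $v$-ideal if $I=I_v$, and a fractional $v$-ideal $I$ is $v$-invertible if $(IJ)_v=D$ for some fractional $v$-ideal $J$. The class group $\mathcal C_v(D)$ is the group of $v$-invertible fractional $v$-ideals, with multiplication $I\cdot_v J=(IJ)_v$, modulo the subgroup of nonzero principal fractional ideals. A prime divisor of $D$ is a $v$-invertible $v$-ideal of $D$ that is a prime ideal of height one. 1. Suppose that for all $a_0,\dots,a_{\mathsf f(S)}\in K$ with $a_0\neq 0$ there exists at least one irreducible polynomial in $K[X]$ whose coefficient at $X^i$ equals $a_i$ for all $i\in\{0,\dots,\mathsf f(S)\}$. Then every class of $\mathcal C_v(K[S])$ contains at least one prime divisor of $K[S]$.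 2. Suppose that for all $a_0,\dots,a_{\mathsf f(S)}\in K$ with $a_0\neq 0$ there exist infinitely many irreducible polynomials in $K[X]$ whose coefficient at $X^i$ equals $a_i$ for all $i\in\{0,\dots,\mathsf f(S)\}$. Then every class of $\mathcal C_v(K[S])$ contains infinitely many prime divisors of $K[S]$. -/

import Mathlib

open scoped nonZeroDivisors Polynomial

/-- A numerical monoid: a submonoid of `(ℕ, +)` with finite complement. -/
def IsNumericalMonoid (S : AddSubmonoid ℕ) : Prop :=
  ((S : Set ℕ)ᶜ).Finite

/-- The Frobenius number of a numerical monoid: the maximum of its complement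
(and `0` if the complement is empty, that is, if `S` is all of `ℕ`). -/
noncomputable def frobeniusNumber (S : AddSubmonoid ℕ) : ℕ :=
  sSup ((S : Set ℕ)ᶜ)

/-- For a proper numerical monoid the Frobenius number is the maximum of the complement. -/
theorem frobeniusNumber_isGreatest (S : AddSubmonoid ℕ) (hS : IsNumericalMonoid S) (hne : S ≠ ⊤) :
    IsGreatest ((S : Set ℕ)ᶜ) (frobeniusNumber S) := by
  have h : ((S : Set ℕ)ᶜ).Nonempty := by
    rw [Set.nonempty_compl]
    intro h
    exact hne (SetLike.coe_injective (by simpa using h))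
  exact ⟨Nat.sSup_mem h hS.bddAbove, fun x hx => le_csSup hS.bddAbove hx⟩

/-! ### Divisorial ideals and the `v`-class group of a domain `R` with quotient field `F` -/

section VIdeals

variable {R : Type*} [CommRing R] [IsDomain R]
variable {F : Type*} [Field F] [Algebra R F] [IsFractionRing R F]

/-- `I_v = (I⁻¹)⁻¹`, where `I⁻¹ = (R : I) = {x ∈ F | x I ⊆ R}`. -/
noncomputable def vClosure (I : FractionalIdeal R⁰ F) : FractionalIdeal R⁰ F :=
  (I⁻¹)⁻¹

/-- A fractional `v`-ideal: a fractional ideal `I` with `I = I_v`. -/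
def IsVIdeal (I : FractionalIdeal R⁰ F) : Prop :=
  vClosure I = I

/-- A `v`-invertible fractional `v`-ideal. -/
def IsVInvertible (I : FractionalIdeal R⁰ F) : Prop :=
  IsVIdeal I ∧ ∃ J : FractionalIdeal R⁰ F, IsVIdeal J ∧ vClosure (I * J) = 1

theorem inv_ne_zero_of_ne_zero {I : FractionalIdeal R⁰ F} (hI : I ≠ 0) : I⁻¹ ≠ 0 := by
  obtain ⟨a, J, ha, h⟩ := FractionalIdeal.exists_eq_spanSingleton_mul I
  intro h0
  have h1 : algebraMap R F a ∈ I⁻¹ := by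
    rw [FractionalIdeal.mem_inv_iff hI]
    intro y hy
    rw [h, FractionalIdeal.mem_singleton_mul] at hy
    obtain ⟨z, hz, rfl⟩ := hy
    have ha' : algebraMap R F a ≠ 0 := by simpa using ha
    rw [mul_inv_cancel_left₀ ha']
    exact FractionalIdeal.coeIdeal_le_one hz
  rw [h0, FractionalIdeal.mem_zero_iff] at h1
  exact ha (by simpa using h1)

theorem vClosure_zero : vClosure (0 : FractionalIdeal R⁰ F) = 0 := by
  simp [vClosure, FractionalIdeal.inv_zero']

theorem vClosure_one : vClosure (1 : FractionalIdeal R⁰ F) = 1 := by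
  simp [vClosure]

theorem le_vClosure (I : FractionalIdeal R⁰ F) : I ≤ vClosure I := by
  by_cases hI : I = 0
  · rw [hI, vClosure_zero]
  intro x hx
  rw [vClosure]
  refine (FractionalIdeal.mem_inv_iff (inv_ne_zero_of_ne_zero hI)).2 fun y hy => ?_
  rw [mul_comm]
  exact (FractionalIdeal.mem_inv_iff hI).1 hy x hx

theorem vClosure_inv (I : FractionalIdeal R⁰ F) : vClosure I⁻¹ = I⁻¹ := by
  by_cases hI : I = 0
  · rw [hI, FractionalIdeal.inv_zero', vClosure_zero]
  refine le_antisymm ?_ (le_vClosure _)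
  have hv : vClosure I ≠ 0 := inv_ne_zero_of_ne_zero (inv_ne_zero_of_ne_zero hI)
  exact FractionalIdeal.inv_anti_mono hI hv (le_vClosure I)

theorem isVIdeal_vClosure (I : FractionalIdeal R⁰ F) : IsVIdeal (vClosure I) :=
  vClosure_inv _

set_option linter.unusedSectionVars false in
theorem fractionalIdeal_mul_ne_zero {I J : FractionalIdeal R⁰ F} (hI : I ≠ 0) (hJ : J ≠ 0) :
    I * J ≠ 0 := by
  intro h
  apply hI
  rw [FractionalIdeal.eq_zero_iff]
  intro x hx
  by_contra hx0
  apply hJ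
  rw [FractionalIdeal.eq_zero_iff]
  intro y hy
  have := FractionalIdeal.mul_mem_mul hx hy
  rw [h, FractionalIdeal.mem_zero_iff] at this
  exact (mul_eq_zero.1 this).resolve_left hx0

theorem vClosure_mul_left (I J : FractionalIdeal R⁰ F) :
    vClosure (vClosure I * J) = vClosure (I * J) := by
  by_cases hI : I = 0
  · rw [hI, vClosure_zero]
  by_cases hJ : J = 0
  · rw [hJ, mul_zero, mul_zero]
  have hv : vClosure I ≠ 0 := inv_ne_zero_of_ne_zero (inv_ne_zero_of_ne_zero hI)
  have hIJ : I * J ≠ 0 := fractionalIdeal_mul_ne_zero hI hJ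
  have hvJ : vClosure I * J ≠ 0 := fractionalIdeal_mul_ne_zero hv hJ
  suffices h : (vClosure I * J)⁻¹ = (I * J)⁻¹ by rw [vClosure, h, vClosure]
  refine le_antisymm
    (FractionalIdeal.inv_anti_mono hIJ hvJ (mul_le_mul_left (le_vClosure I) J)) ?_
  intro x hx
  refine (FractionalIdeal.mem_inv_iff hvJ).2 fun y hy => ?_
  refine FractionalIdeal.mul_induction_on hy (fun i hi j hj => ?_) (fun a b ha hb => ?_)
  · have hxj : x * j ∈ (vClosure I)⁻¹ := by
      have : (vClosure I)⁻¹ = I⁻¹ := vClosure_inv I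
      rw [this, FractionalIdeal.mem_inv_iff hI]
      intro k hk
      have := (FractionalIdeal.mem_inv_iff hIJ).1 hx (k * j) (FractionalIdeal.mul_mem_mul hk hj)
      rwa [mul_assoc, mul_comm j k]
    have := (FractionalIdeal.mem_inv_iff hv).1 hxj i hi
    rwa [mul_comm i j, ← mul_assoc]
  · rw [mul_add]
    exact Submodule.add_mem _ ha hb

theorem vClosure_mul_right (I J : FractionalIdeal R⁰ F) :
    vClosure (I * vClosure J) = vClosure (I * J) := by
  rw [mul_comm, vClosure_mul_left, mul_comm]

theorem isVInvertible_one : IsVInvertible (1 : FractionalIdeal R⁰ F) :=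
  ⟨vClosure_one, 1, vClosure_one, by rw [mul_one, vClosure_one]⟩

theorem IsVInvertible.vMul {I J : FractionalIdeal R⁰ F} (hI : IsVInvertible I)
    (hJ : IsVInvertible J) : IsVInvertible (vClosure (I * J)) := by
  obtain ⟨-, I', -, h⟩ := hI
  obtain ⟨-, J', -, h'⟩ := hJ
  refine ⟨isVIdeal_vClosure _, vClosure (I' * J'), isVIdeal_vClosure _, ?_⟩
  rw [vClosure_mul_left, vClosure_mul_right, mul_mul_mul_comm, ← vClosure_mul_left, h, one_mul, h']

theorem isVInvertible_spanSingleton (x : Fˣ) :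
    IsVInvertible (FractionalIdeal.spanSingleton R⁰ (x : F)) := by
  have h (y : Fˣ) : IsVIdeal (FractionalIdeal.spanSingleton R⁰ (y : F)) := by
    simp [IsVIdeal, vClosure, FractionalIdeal.spanSingleton_inv]
  refine ⟨h x, _, h x⁻¹, ?_⟩
  rw [FractionalIdeal.spanSingleton_mul_spanSingleton]
  simp [vClosure_one]

variable (R F)

/-- The `v`-invertible fractional `v`-ideals of `R`. -/
@[ext]
structure VInvertibleIdeal where
  ideal : FractionalIdeal R⁰ F
  isVInvertible : IsVInvertible ideal

/-- The group of `v`-invertible fractional `v`-ideals, with multiplication `I ·_v J = (IJ)_v`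
and identity element `R`. -/
noncomputable instance : CommGroup (VInvertibleIdeal R F) where
  mul I J := ⟨vClosure (I.ideal * J.ideal), I.isVInvertible.vMul J.isVInvertible⟩
  one := ⟨1, isVInvertible_one⟩
  inv I := ⟨I.isVInvertible.2.choose, I.isVInvertible.2.choose_spec.1, I.ideal, I.isVInvertible.1, by
    rw [mul_comm]; exact I.isVInvertible.2.choose_spec.2⟩
  mul_assoc I J L := VInvertibleIdeal.ext (by
    change vClosure (vClosure (I.ideal * J.ideal) * L.ideal) = vClosure (I.ideal * vClosure (J.ideal * L.ideal))
    rw [vClosure_mul_left, vClosure_mul_right, mul_assoc])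
  one_mul I := VInvertibleIdeal.ext (by
    change vClosure (1 * I.ideal) = I.ideal
    rw [one_mul]; exact I.isVInvertible.1)
  mul_one I := VInvertibleIdeal.ext (by
    change vClosure (I.ideal * 1) = I.ideal
    rw [mul_one]; exact I.isVInvertible.1)
  mul_comm I J := VInvertibleIdeal.ext (by
    change vClosure (I.ideal * J.ideal) = vClosure (J.ideal * I.ideal)
    rw [mul_comm])
  inv_mul_cancel I := VInvertibleIdeal.ext (by
    change vClosure (I.isVInvertible.2.choose * I.ideal) = 1
    rw [mul_comm]; exact I.isVInvertible.2.choose_spec.2)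

/-- The homomorphism sending `x ∈ Fˣ` to the principal fractional ideal `xR`. -/
noncomputable def principalVIdeal : Fˣ →* VInvertibleIdeal R F where
  toFun x := ⟨FractionalIdeal.spanSingleton R⁰ (x : F), isVInvertible_spanSingleton x⟩
  map_one' := VInvertibleIdeal.ext (by
    change FractionalIdeal.spanSingleton R⁰ ((1 : Fˣ) : F) = 1
    simp)
  map_mul' x y := VInvertibleIdeal.ext (by
    change FractionalIdeal.spanSingleton R⁰ ((x * y : Fˣ) : F) =
      vClosure (FractionalIdeal.spanSingleton R⁰ (x : F) *
        FractionalIdeal.spanSingleton R⁰ (y : F))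
    rw [FractionalIdeal.spanSingleton_mul_spanSingleton, ← Units.val_mul]
    exact (isVInvertible_spanSingleton (x * y)).1.symm)

/-- The `v`-class group: `v`-invertible fractional `v`-ideals modulo the nonzero principal
fractional ideals. -/
abbrev VClassGroup : Type _ :=
  VInvertibleIdeal R F ⧸ (principalVIdeal R F).range

variable {R F}

/-- The class `[I]` of a `v`-invertible fractional `v`-ideal `I`. -/
noncomputable def vClass (I : FractionalIdeal R⁰ F) (hI : IsVInvertible I) : VClassGroup R F :=
  QuotientGroup.mk (⟨I, hI⟩ : VInvertibleIdeal R F)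

/-- The prime divisors (`v`-invertible height-one prime ideals) of `R` that lie in the class `c`. -/
def primeDivisorsInClass (c : VClassGroup R F) : Set (Ideal R) :=
  {P | P.IsPrime ∧ P.height = 1 ∧
    ∃ hP : IsVInvertible (P : FractionalIdeal R⁰ F), vClass (P : FractionalIdeal R⁰ F) hP = c}

end VIdeals

/-- For a field `K`, the polynomials in `K[X]` that are irreducible and have the prescribed
lowest coefficients `a 0, …, a n`. -/
def irreduciblesWithLowCoeffs {K : Type*} [Field K] {n : ℕ} (a : Fin (n + 1) → K) : Set K[X] :=
  {p | Irreducible p ∧ ∀ i : Fin (n + 1), p.coeff i = a i}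

/-!
Every class of `C_v(K[S])` is represented by an integral ideal `I` of `K[S]` containing an element
with nonzero constant coefficient (`exists_ideal_not_le_of_vClass`): the ideal `M` of elements
with constant coefficient `0` satisfies `M⁻¹ ≠ K[S]`, so a product `IJ` with `(IJ)_v = K[S]` is not
contained in `M`. Such an ideal is comaximal with the conductor of `K[S]` in `K[X]`, which contains
`X ^ (f(S) + 1) K[X]`; since `K[X]` is a principal ideal domain, `I = g K[X] ∩ K[S]` for some `g`
with `g(0) ≠ 0` (`exists_eq_contractedSpan`).

If `p` is irreducible with the same coefficients as `g` up to `f(S)`, then `p - g` lies in the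
conductor, so `g d ∈ K[S]` if and only if `p d ∈ K[S]`. Hence `p K[X] ∩ K[S] = (p / g) I` lies in
the class of `I` (`exists_span_mul_contractedSpan_eq`). It is a nonzero prime ideal of `K[S]`, of
height one because `K[X]` is integral over `K[S]`. Distinct `p` give distinct primes, because
`p K[X] ∩ K[S]` and the constant coefficient determine `p` (`injOn_contractedSpan`).
-/

/-! ### Classes of divisorial ideals -/

section VIdeals

variable {R : Type*} [CommRing R] [IsDomain R]
variable {F : Type*} [Field F] [Algebra R F] [IsFractionRing R F]

theorem vClosure_spanSingleton_mul (x : Fˣ) {I : FractionalIdeal R⁰ F} (hI : IsVIdeal I) :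
    vClosure (FractionalIdeal.spanSingleton R⁰ (x : F) * I) =
      FractionalIdeal.spanSingleton R⁰ (x : F) * I := by
  have hx : FractionalIdeal.spanSingleton R⁰ (x : F) *
      FractionalIdeal.spanSingleton R⁰ ((x⁻¹ : Fˣ) : F) = 1 := by
    rw [FractionalIdeal.spanSingleton_mul_spanSingleton]
    simp
  refine le_antisymm ?_ (le_vClosure _)
  set u := FractionalIdeal.spanSingleton R⁰ (x : F)
  set v := FractionalIdeal.spanSingleton R⁰ ((x⁻¹ : Fˣ) : F)
  calc vClosure (u * I) = u * (v * vClosure (u * I)) := by rw [← mul_assoc, hx, one_mul]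
    _ ≤ u * vClosure (v * vClosure (u * I)) := mul_le_mul_right (le_vClosure _) u
    _ = u * I := by rw [vClosure_mul_right, ← mul_assoc, mul_comm v, hx, one_mul, hI]

/-- Multiplying by a nonzero element of the quotient field changes neither `v`-invertibility nor
the class. -/
theorem exists_vClass_spanSingleton_mul (x : Fˣ) {I J : FractionalIdeal R⁰ F}
    (hI : IsVInvertible I) (hJ : J = FractionalIdeal.spanSingleton R⁰ (x : F) * I) :
    ∃ h : IsVInvertible J, vClass J h = vClass I hI := by
  have key : (principalVIdeal R F x * ⟨I, hI⟩ : VInvertibleIdeal R F).ideal = J :=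
    (vClosure_spanSingleton_mul x hI.1).trans hJ.symm
  subst key
  refine ⟨(principalVIdeal R F x * ⟨I, hI⟩ : VInvertibleIdeal R F).isVInvertible, ?_⟩
  have hmem : (principalVIdeal R F x * ⟨I, hI⟩ : VInvertibleIdeal R F)⁻¹ * ⟨I, hI⟩ ∈
      (principalVIdeal R F).range :=
    ⟨x⁻¹, by rw [map_inv, mul_inv, inv_mul_cancel_right]⟩
  exact QuotientGroup.eq.2 hmem

/-- The criterion for `J` to lie in the class of `I` with all denominators cleared, so that it is
a statement about ideals of `R` only. -/
theorem exists_vClass_eq_of_span_mul_eq {a b : R} (ha : a ≠ 0) (hb : b ≠ 0) {I J : Ideal R}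
    (h : Ideal.span {a} * J = Ideal.span {b} * I) (hI : IsVInvertible (I : FractionalIdeal R⁰ F)) :
    ∃ hJ : IsVInvertible (J : FractionalIdeal R⁰ F), vClass (J : FractionalIdeal R⁰ F) hJ =
      vClass (I : FractionalIdeal R⁰ F) hI := by
  have ha' : algebraMap R F a ≠ 0 := by simpa using ha
  have hb' : algebraMap R F b ≠ 0 := by simpa using hb
  refine exists_vClass_spanSingleton_mul ((Units.mk0 _ ha')⁻¹ * Units.mk0 _ hb') hI ?_
  have h' := congrArg (fun L : Ideal R => (L : FractionalIdeal R⁰ F)) h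
  simp only [FractionalIdeal.coeIdeal_mul, FractionalIdeal.coeIdeal_span_singleton] at h'
  rw [Units.val_mul, ← FractionalIdeal.spanSingleton_mul_spanSingleton, mul_assoc, Units.val_mk0,
    ← h', ← mul_assoc, FractionalIdeal.spanSingleton_mul_spanSingleton]
  simp [ha']

/-- If `M` is an ideal with `M⁻¹ ≠ R`, as witnessed by the fraction `a / b`, then each class
contains an integral ideal that is not contained in `M`. For if `(IJ)_v = R`, then `IJ ⊆ M` would
give `a / b ∈ (IJ)⁻¹ = R`; so `ij ∉ M` for some `i ∈ I` and `j ∈ J`, and `jI` is the required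
ideal. -/
theorem exists_ideal_not_le_of_vClass (M : Ideal R) {a b : R} (hb : b ≠ 0)
    (hab : ¬ b ∣ a) (hM : ∀ m ∈ M, b ∣ a * m) (c : VClassGroup R F) :
    ∃ (I : Ideal R) (hI : IsVInvertible (I : FractionalIdeal R⁰ F)),
      ¬ I ≤ M ∧ vClass (I : FractionalIdeal R⁰ F) hI = c := by
  induction c using QuotientGroup.induction_on with | H I =>
  obtain ⟨I, hI⟩ := I
  have hb' : algebraMap R F b ≠ 0 := by simpa using hb
  obtain ⟨J, -, hIJ⟩ := hI.2
  have hle : I * J ≤ 1 := hIJ ▸ le_vClosure _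
  have hne : I * J ≠ 0 := by
    intro h
    rw [h, vClosure_zero] at hIJ
    exact zero_ne_one hIJ
  have hinv : (I * J)⁻¹ = 1 := by
    rw [← vClosure_inv]
    change (vClosure (I * J))⁻¹ = 1
    rw [hIJ, inv_one]
  have hnot : ¬ I * J ≤ (M : FractionalIdeal R⁰ F) := by
    intro h
    have hmem : algebraMap R F a / algebraMap R F b ∈ (I * J)⁻¹ := by
      rw [FractionalIdeal.mem_inv_iff hne]
      intro y hy
      obtain ⟨m, hm, rfl⟩ := (FractionalIdeal.mem_coeIdeal _).1 (h hy)
      obtain ⟨r, hr⟩ := hM m hm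
      refine (FractionalIdeal.mem_one_iff _).2 ⟨r, ?_⟩
      rw [div_mul_eq_mul_div, ← map_mul, hr, map_mul, mul_div_cancel_left₀ _ hb']
    rw [hinv, FractionalIdeal.mem_one_iff] at hmem
    obtain ⟨r, hr⟩ := hmem
    rw [eq_div_iff hb', ← map_mul] at hr
    exact hab ⟨r, by rw [mul_comm]; exact (IsFractionRing.injective R F hr).symm⟩
  rw [FractionalIdeal.mul_le] at hnot
  push Not at hnot
  obtain ⟨i, hi, j, hj, hij⟩ := hnot
  have hj0 : j ≠ 0 := by
    rintro rfl
    exact hij (by rw [mul_zero]; exact Submodule.zero_mem _)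
  have hjI : FractionalIdeal.spanSingleton R⁰ j * I ≤ 1 := by
    intro y hy
    obtain ⟨k, hk, rfl⟩ := FractionalIdeal.mem_singleton_mul.1 hy
    rw [mul_comm]
    exact hle (FractionalIdeal.mul_mem_mul hk hj)
  obtain ⟨L, hL⟩ := FractionalIdeal.le_one_iff_exists_coeIdeal.1 hjI
  obtain ⟨hLv, hcl⟩ := exists_vClass_spanSingleton_mul (Units.mk0 j hj0) hI hL
  refine ⟨L, hLv, fun hLM => hij ?_, hcl⟩
  have : i * j ∈ (L : FractionalIdeal R⁰ F) := by
    rw [hL, mul_comm i j]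
    exact FractionalIdeal.mem_singleton_mul.2 ⟨i, hi, rfl⟩
  exact (FractionalIdeal.coeIdeal_le_coeIdeal F).2 hLM this

end VIdeals

/-! ### The embedding of `K[S]` into `K[X]` -/

section NumericalMonoidAlgebra

variable {K : Type*} [Field K] (S : AddSubmonoid ℕ)

/-- The inclusion of the monoid algebra `K[S]` into `K[X]`, sending `s ∈ S` to `X ^ s`. -/
noncomputable def monoidAlgebraToPolynomial : AddMonoidAlgebra K S →ₐ[K] K[X] :=
  (Polynomial.toFinsuppIsoAlg K).symm.toAlgHom.comp (AddMonoidAlgebra.mapDomainAlgHom K K S.subtype)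

theorem coeff_monoidAlgebraToPolynomial (r : AddMonoidAlgebra K S) (k : ℕ) :
    (monoidAlgebraToPolynomial S r).coeff k = Finsupp.mapDomain S.subtype r.coeff k := rfl

theorem monoidAlgebraToPolynomial_injective :
    Function.Injective (monoidAlgebraToPolynomial (K := K) S) := by
  refine (Polynomial.toFinsuppIsoAlg K).symm.injective.comp ?_
  exact AddMonoidAlgebra.mapDomain_injective Subtype.val_injective

theorem coeff_monoidAlgebraToPolynomial_of_notMem {k : ℕ} (hk : k ∉ S) (r : AddMonoidAlgebra K S) :
    (monoidAlgebraToPolynomial S r).coeff k = 0 := by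
  rw [coeff_monoidAlgebraToPolynomial]
  refine Finsupp.mapDomain_of_notMem_range _ _ ?_
  rintro ⟨s, rfl⟩
  exact hk s.2

theorem exists_monoidAlgebraToPolynomial_eq {d : K[X]} (hd : ∀ k, d.coeff k ≠ 0 → k ∈ S) :
    ∃ r, monoidAlgebraToPolynomial S r = d := by
  rw [d.as_sum_support_C_mul_X_pow]
  refine Subring.sum_mem (monoidAlgebraToPolynomial (K := K) S).toRingHom.range fun k hk => ?_
  refine ⟨AddMonoidAlgebra.single ⟨k, hd k (Polynomial.mem_support_iff.1 hk)⟩ (d.coeff k), ?_⟩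
  ext n
  rw [Polynomial.coeff_C_mul_X_pow]
  refine (coeff_monoidAlgebraToPolynomial S _ n).trans ?_
  simp [Finsupp.mapDomain_single, Finsupp.single_apply, eq_comm]

variable {S}

theorem mem_of_frobeniusNumber_lt (hS : IsNumericalMonoid S) {k : ℕ} (hk : frobeniusNumber S < k) :
    k ∈ S := by
  by_contra h
  exact absurd (le_csSup hS.bddAbove h) (not_le.2 hk)

/-- `X ^ (f(S) + 1) K[X]` lies in the conductor of `K[S]` in `K[X]`. -/
theorem exists_monoidAlgebraToPolynomial_eq_of_X_pow_dvd (hS : IsNumericalMonoid S) {d : K[X]}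
    (hd : Polynomial.X ^ (frobeniusNumber S + 1) ∣ d) :
    ∃ r, monoidAlgebraToPolynomial S r = d := by
  refine exists_monoidAlgebraToPolynomial_eq S fun k hk => mem_of_frobeniusNumber_lt hS ?_
  by_contra h
  exact hk (Polynomial.X_pow_dvd_iff.1 hd k (by omega))

theorem isIntegral_monoidAlgebraToPolynomial (hS : IsNumericalMonoid S) :
    (monoidAlgebraToPolynomial (K := K) S).toRingHom.IsIntegral := by
  let φ := (monoidAlgebraToPolynomial (K := K) S).toRingHom
  have hX : φ.IsIntegralElem Polynomial.X := by
    obtain ⟨r, hr⟩ := exists_monoidAlgebraToPolynomial_eq_of_X_pow_dvd (K := K) hS dvd_rfl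
    have h : φ.IsIntegralElem (Polynomial.X ^ (frobeniusNumber S + 1)) := hr ▸ φ.isIntegralElem_map
    let := φ.toAlgebra
    exact IsIntegral.of_pow (R := AddMonoidAlgebra K S) (Nat.succ_pos _) h
  have hC (a : K) : φ.IsIntegralElem (Polynomial.C a) := by
    have : φ (algebraMap K _ a) = Polynomial.C a := (monoidAlgebraToPolynomial S).commutes a
    exact this ▸ φ.isIntegralElem_map
  intro d
  induction d using Polynomial.induction_on' with
  | add p q hp hq => exact hp.add φ hq
  | monomial n a =>
    rw [← Polynomial.C_mul_X_pow_eq_monomial]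
    refine (hC a).mul φ ?_
    induction n with
    | zero => simpa using φ.isIntegralElem_one
    | succ n ih => exact pow_succ (Polynomial.X : K[X]) n ▸ ih.mul φ hX

theorem height_eq_one_of_isPrime (hS : IsNumericalMonoid S) {P : Ideal (AddMonoidAlgebra K S)}
    (hP : P.IsPrime) (hP0 : P ≠ ⊥) : P.height = 1 := by
  have hmax (Q : Ideal (AddMonoidAlgebra K S)) (hQ : Q.IsPrime) (hQ0 : Q ≠ ⊥) : Q.IsMaximal := by
    let := (monoidAlgebraToPolynomial (K := K) S).toRingHom.toAlgebra
    have : Algebra.IsIntegral (AddMonoidAlgebra K S) K[X] :=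
      ⟨isIntegral_monoidAlgebraToPolynomial hS⟩
    have hinj : Function.Injective (algebraMap (AddMonoidAlgebra K S) K[X]) :=
      monoidAlgebraToPolynomial_injective S
    obtain ⟨Q', -, hQ', rfl⟩ := Ideal.exists_ideal_over_prime_of_isIntegral Q (⊥ : Ideal K[X])
      (by rw [← RingHom.ker_eq_comap_bot, (RingHom.injective_iff_ker_eq_bot _).1 hinj]; exact bot_le)
    have hQ'0 : Q' ≠ ⊥ := by
      rintro rfl
      exact hQ0 (by rw [← RingHom.ker_eq_comap_bot, (RingHom.injective_iff_ker_eq_bot _).1 hinj])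
    have := hQ'.isMaximal hQ'0
    exact Ideal.isMaximal_comap_of_isIntegral_of_isMaximal Q'
  have hdim : Ring.KrullDimLE 1 (AddMonoidAlgebra K S) :=
    Ring.krullDimLE_one_iff_of_noZeroDivisors.2 fun Q hQ0 hQ => hmax Q hQ hQ0
  refine le_antisymm ?_ (Order.one_le_iff_ne_zero.2 (Ideal.height_eq_zero_iff_eq_bot.not.2 hP0))
  have h1 := Ideal.height_le_ringKrullDim_of_isPrime (I := P)
  have h2 : ringKrullDim (AddMonoidAlgebra K S) ≤ (1 : ℕ) := Ring.krullDimLE_iff.1 hdim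
  exact_mod_cast h1.trans h2

/-! ### Contractions of principal ideals of `K[X]` -/

variable (S) in
/-- The contraction `g K[X] ∩ K[S]`. -/
noncomputable def contractedSpan (g : K[X]) : Ideal (AddMonoidAlgebra K S) :=
  (Ideal.span {g}).comap (monoidAlgebraToPolynomial S)

theorem mem_contractedSpan {g : K[X]} {r : AddMonoidAlgebra K S} :
    r ∈ contractedSpan S g ↔ g ∣ monoidAlgebraToPolynomial S r :=
  Ideal.mem_span_singleton

/-- The ideal of the elements with constant coefficient `0` has an inverse strictly larger than
`K[S]`: the inverse contains `X ^ f(S)` if `S ≠ ℕ`, and `X⁻¹` if `S = ℕ`. -/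
theorem exists_fraction_mem_inv_contractedSpan_X (hS : IsNumericalMonoid S) :
    ∃ a b : AddMonoidAlgebra K S, b ≠ 0 ∧ ¬ b ∣ a ∧
      ∀ m ∈ contractedSpan S Polynomial.X, b ∣ a * m := by
  have hinj := monoidAlgebraToPolynomial_injective (K := K) S
  set φ := monoidAlgebraToPolynomial (K := K) S with hφ
  by_cases htop : S = ⊤
  · obtain ⟨b, hb⟩ : ∃ b, φ b = Polynomial.X :=
      exists_monoidAlgebraToPolynomial_eq S fun k _ => htop ▸ AddSubmonoid.mem_top k
    refine ⟨1, b, ?_, ?_, ?_⟩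
    · rintro rfl
      exact Polynomial.X_ne_zero (hb.symm.trans (map_zero φ))
    · intro h
      have := map_dvd φ h
      rw [hb, map_one] at this
      exact Polynomial.not_isUnit_X (isUnit_of_dvd_one this)
    · intro m hm
      obtain ⟨d, hd⟩ := mem_contractedSpan.1 hm
      obtain ⟨r, hr⟩ : ∃ r, φ r = d :=
        exists_monoidAlgebraToPolynomial_eq S fun k _ => htop ▸ AddSubmonoid.mem_top k
      refine ⟨r, hinj ?_⟩
      rw [one_mul, map_mul, hb, hr, hd]
  · have hf : frobeniusNumber S ∉ S := (frobeniusNumber_isGreatest S hS htop).1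
    set f := frobeniusNumber S
    -- `X ^ f` is written as `a / b` with `a` and `b` in the conductor.
    obtain ⟨b, hb⟩ : ∃ b, φ b = Polynomial.X ^ (f + 1) :=
      exists_monoidAlgebraToPolynomial_eq_of_X_pow_dvd hS dvd_rfl
    obtain ⟨a, ha⟩ : ∃ a, φ a = Polynomial.X ^ (f + 1) * Polynomial.X ^ f :=
      exists_monoidAlgebraToPolynomial_eq_of_X_pow_dvd hS (dvd_mul_right _ _)
    have hX : (Polynomial.X ^ (f + 1) : K[X]) ≠ 0 := pow_ne_zero _ Polynomial.X_ne_zero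
    refine ⟨a, b, ?_, ?_, ?_⟩
    · rintro rfl
      exact hX (hb.symm.trans (map_zero φ))
    · rintro ⟨r, rfl⟩
      rw [map_mul, hb] at ha
      have h1 := coeff_monoidAlgebraToPolynomial_of_notMem S hf r
      rw [← hφ, mul_left_cancel₀ hX ha] at h1
      simp at h1
    · intro m hm
      obtain ⟨d, hd⟩ := mem_contractedSpan.1 hm
      obtain ⟨r, hr⟩ : ∃ r, φ r = Polynomial.X ^ (f + 1) * d :=
        exists_monoidAlgebraToPolynomial_eq_of_X_pow_dvd hS (dvd_mul_right _ _)
      refine ⟨r, hinj ?_⟩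
      rw [map_mul, map_mul, ha, hb, hr]
      rw [show φ m = Polynomial.X * d from hd]
      ring

/-- An ideal of `K[S]` containing an element with nonzero constant coefficient is comaximal with
the conductor, hence is contracted from `K[X]`. -/
theorem exists_eq_contractedSpan (hS : IsNumericalMonoid S) {I : Ideal (AddMonoidAlgebra K S)}
    (hI : ¬ I ≤ contractedSpan S Polynomial.X) :
    ∃ g : K[X], g.coeff 0 ≠ 0 ∧ I = contractedSpan S g := by
  have hinj := monoidAlgebraToPolynomial_injective (K := K) S
  set φ := monoidAlgebraToPolynomial (K := K) S with hφ
  set n := frobeniusNumber S + 1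
  obtain ⟨w, hwI, hw⟩ := SetLike.not_le_iff_exists.1 hI
  rw [mem_contractedSpan, Polynomial.X_dvd_iff, ← hφ] at hw
  let g := Submodule.IsPrincipal.generator (I.map φ)
  have hg : Ideal.span {g} = I.map φ := Ideal.span_singleton_generator _
  have hdvd {y : AddMonoidAlgebra K S} (hy : y ∈ I) : g ∣ φ y := by
    rw [← Ideal.mem_span_singleton, hg]
    exact Ideal.mem_map_of_mem φ hy
  refine ⟨g, fun h0 => hw ?_, le_antisymm (fun y hy => mem_contractedSpan.2 (hdvd hy)) ?_⟩
  · obtain ⟨d, hd⟩ := hdvd hwI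
    rw [hd, Polynomial.mul_coeff_zero, h0, zero_mul]
  -- The conductor multiplies the extension of `I` to `K[X]` back into `I`.
  have hcond : ∀ y ∈ I.map φ, ∀ d, ∃ r ∈ I, φ r = Polynomial.X ^ n * d * y := by
    intro y hy
    refine Submodule.span_induction ?_ ?_ ?_ ?_ hy
    · rintro _ ⟨i, hi, rfl⟩ d
      obtain ⟨s, hs⟩ := exists_monoidAlgebraToPolynomial_eq_of_X_pow_dvd (K := K) hS
        (dvd_mul_right (Polynomial.X ^ n) d)
      exact ⟨s * i, I.mul_mem_left s hi, by rw [map_mul, ← hs]⟩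
    · intro d
      exact ⟨0, I.zero_mem, by simp⟩
    · intro y z _ _ hy hz d
      obtain ⟨r, hr, h⟩ := hy d
      obtain ⟨r', hr', h'⟩ := hz d
      exact ⟨r + r', I.add_mem hr hr', by rw [map_add, h, h', mul_add]⟩
    · intro e y _ hy d
      obtain ⟨r, hr, h⟩ := hy (d * e)
      exact ⟨r, hr, by rw [h, smul_eq_mul]; ring⟩
  intro x hx
  obtain ⟨d, hd⟩ := mem_contractedSpan.1 hx
  -- Normalize `w` to have constant coefficient `1`.
  set c : AddMonoidAlgebra K S := algebraMap K _ ((φ w).coeff 0)⁻¹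
  have hφc : φ c = Polynomial.C ((φ w).coeff 0)⁻¹ := φ.commutes _
  have hX : Polynomial.X ∣ φ (1 - c * w) := by
    rw [Polynomial.X_dvd_iff, map_sub, map_mul, hφc, map_one]
    simp [hw]
  obtain ⟨e, he⟩ := pow_dvd_pow_of_dvd hX n
  obtain ⟨v, hv⟩ : c * w ∣ 1 - (1 - c * w) ^ n := by
    simpa using one_sub_dvd_one_sub_pow (1 - c * w) n
  obtain ⟨r, hrI, hr⟩ := hcond (φ x) (by rw [← hg, Ideal.mem_span_singleton]; exact ⟨d, hd⟩) e
  have hrx : r = (1 - c * w) ^ n * x := hinj (by rw [hr, map_mul, map_pow, he])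
  have hx' : x = (c * v * x) * w + r := by
    rw [hrx]
    linear_combination x * hv
  rw [hx']
  exact I.add_mem (I.mul_mem_left _ hwI) hrI

/-- Two polynomials with the same coefficients up to `f(S)` differ by an element of the conductor,
so that `g d` and `p d` lie in `K[S]` simultaneously. -/
theorem exists_span_mul_contractedSpan_eq (hS : IsNumericalMonoid S) {g p : K[X]} (hg : g ≠ 0)
    (hp : p ≠ 0) (h : Polynomial.X ^ (frobeniusNumber S + 1) ∣ p - g) :
    ∃ a b : AddMonoidAlgebra K S, a ≠ 0 ∧ b ≠ 0 ∧
      Ideal.span {a} * contractedSpan S p = Ideal.span {b} * contractedSpan S g := by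
  have hinj := monoidAlgebraToPolynomial_injective (K := K) S
  have key {p g : K[X]} (hg : g ≠ 0) (h : Polynomial.X ^ (frobeniusNumber S + 1) ∣ p - g)
      {a b : AddMonoidAlgebra K S}
      (ha : monoidAlgebraToPolynomial S a = Polynomial.X ^ (frobeniusNumber S + 1) * g)
      (hb : monoidAlgebraToPolynomial S b = Polynomial.X ^ (frobeniusNumber S + 1) * p) :
      Ideal.span {b} * contractedSpan S g ≤ Ideal.span {a} * contractedSpan S p := by
    intro y hy
    obtain ⟨z, hz, rfl⟩ := Ideal.mem_span_singleton_mul.1 hy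
    obtain ⟨d, hd⟩ := mem_contractedSpan.1 hz
    obtain ⟨r, hr⟩ := exists_monoidAlgebraToPolynomial_eq_of_X_pow_dvd hS (h.mul_right d)
    have hzr : monoidAlgebraToPolynomial S (z + r) = p * d := by
      rw [map_add, hd, hr]
      ring
    refine Ideal.mem_span_singleton_mul.2
      ⟨z + r, mem_contractedSpan.2 (hzr ▸ dvd_mul_right p d), hinj ?_⟩
    rw [map_mul, map_mul, hzr, ha, hb, hd]
    ring
  have hX : (Polynomial.X ^ (frobeniusNumber S + 1) : K[X]) ≠ 0 :=
    pow_ne_zero _ Polynomial.X_ne_zero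
  obtain ⟨a, ha⟩ := exists_monoidAlgebraToPolynomial_eq_of_X_pow_dvd hS
    (dvd_mul_right (Polynomial.X ^ (frobeniusNumber S + 1)) g)
  obtain ⟨b, hb⟩ := exists_monoidAlgebraToPolynomial_eq_of_X_pow_dvd hS
    (dvd_mul_right (Polynomial.X ^ (frobeniusNumber S + 1)) p)
  refine ⟨a, b, ?_, ?_, le_antisymm (key hp (by simpa using h.neg_right) hb ha) (key hg h ha hb)⟩
  · rintro rfl
    exact mul_ne_zero hX hg (ha.symm.trans (map_zero _))
  · rintro rfl
    exact mul_ne_zero hX hp (hb.symm.trans (map_zero _))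

theorem contractedSpan_ne_bot (hS : IsNumericalMonoid S) {p : K[X]} (hp : p ≠ 0) :
    contractedSpan S p ≠ ⊥ := by
  obtain ⟨b, hb⟩ := exists_monoidAlgebraToPolynomial_eq_of_X_pow_dvd hS
    (dvd_mul_right (Polynomial.X ^ (frobeniusNumber S + 1)) p)
  intro h
  have hmem : b ∈ contractedSpan S p := mem_contractedSpan.2 (hb ▸ dvd_mul_left p _)
  rw [h, Ideal.mem_bot] at hmem
  subst hmem
  exact mul_ne_zero (pow_ne_zero _ Polynomial.X_ne_zero) hp (hb.symm.trans (map_zero _))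

theorem dvd_of_contractedSpan_le (hS : IsNumericalMonoid S) {p q : K[X]} (hq : Irreducible q)
    (hq0 : q.coeff 0 ≠ 0) (h : contractedSpan S p ≤ contractedSpan S q) : q ∣ p := by
  obtain ⟨b, hb⟩ := exists_monoidAlgebraToPolynomial_eq_of_X_pow_dvd hS
    (dvd_mul_right (Polynomial.X ^ (frobeniusNumber S + 1)) p)
  have hmem := mem_contractedSpan.1 (h (mem_contractedSpan.2 (hb ▸ dvd_mul_left p _)))
  rw [hb] at hmem
  refine (hq.prime.dvd_or_dvd hmem).resolve_left fun hqX => hq0 ?_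
  have hX := (hq.associated_of_dvd Polynomial.irreducible_X (hq.prime.dvd_of_dvd_pow hqX)).symm.dvd
  exact Polynomial.X_dvd_iff.1 hX

theorem injOn_contractedSpan (hS : IsNumericalMonoid S) {c : K} (hc : c ≠ 0) :
    Set.InjOn (contractedSpan S) {p : K[X] | Irreducible p ∧ p.coeff 0 = c} := by
  rintro p ⟨hp, hpc⟩ q ⟨hq, hqc⟩ h
  obtain ⟨u, hu⟩ := dvd_of_contractedSpan_le hS hp (hpc ▸ hc) h.ge
  have hunit : IsUnit u := (hq.isUnit_or_isUnit hu).resolve_left hp.not_isUnit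
  obtain ⟨a, -, rfl⟩ := Polynomial.isUnit_iff.1 hunit
  rw [hu, Polynomial.mul_coeff_zero, Polynomial.coeff_C_zero, hpc] at hqc
  rw [hu, mul_left_cancel₀ hc (hqc.trans (mul_one c).symm), Polynomial.C_1, mul_one]

/-- For each class there is a prescription of the coefficients up to `f(S)`, namely those of a
generator `g` as in `exists_eq_contractedSpan`, such that every irreducible polynomial satisfying
it contracts to a prime divisor in the class. -/
theorem exists_mapsTo_primeDivisorsInClass (hS : IsNumericalMonoid S)
    (c : VClassGroup (AddMonoidAlgebra K S) (FractionRing (AddMonoidAlgebra K S))) :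
    ∃ a : Fin (frobeniusNumber S + 1) → K, a 0 ≠ 0 ∧
      Set.MapsTo (contractedSpan S) (irreduciblesWithLowCoeffs a) (primeDivisorsInClass c) := by
  obtain ⟨a, b, hb, hab, hM⟩ := exists_fraction_mem_inv_contractedSpan_X (K := K) hS
  obtain ⟨I, hI, hIX, hIc⟩ := exists_ideal_not_le_of_vClass _ hb hab hM c
  obtain ⟨g, hg0, rfl⟩ := exists_eq_contractedSpan hS hIX
  refine ⟨fun i => g.coeff i, hg0, ?_⟩
  rintro p ⟨hp, hpg⟩
  have hg : g ≠ 0 := by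
    rintro rfl
    exact hg0 (Polynomial.coeff_zero 0)
  have hdvd : Polynomial.X ^ (frobeniusNumber S + 1) ∣ p - g := by
    rw [Polynomial.X_pow_dvd_iff]
    intro k hk
    rw [Polynomial.coeff_sub, sub_eq_zero]
    exact hpg ⟨k, hk⟩
  have hprime : (contractedSpan S p).IsPrime := by
    have : (Ideal.span {p}).IsPrime := (Ideal.span_singleton_prime hp.ne_zero).2 hp.prime
    exact Ideal.comap_isPrime _ _
  obtain ⟨a, b, ha, hb, h⟩ := exists_span_mul_contractedSpan_eq hS hg hp.ne_zero hdvd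
  obtain ⟨hP, hPc⟩ := exists_vClass_eq_of_span_mul_eq ha hb h hI
  exact ⟨hprime, height_eq_one_of_isPrime hS hprime (contractedSpan_ne_bot hS hp.ne_zero), hP,
    hPc.trans hIc⟩

end NumericalMonoidAlgebra

theorem mainTheorem2 {K : Type*} [Field K] (S : AddSubmonoid ℕ) (hS : IsNumericalMonoid S) :
    ((∀ a : Fin (frobeniusNumber S + 1) → K, a 0 ≠ 0 →
        (irreduciblesWithLowCoeffs a).Nonempty) →
      ∀ c : VClassGroup (AddMonoidAlgebra K S) (FractionRing (AddMonoidAlgebra K S)),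
        (primeDivisorsInClass c).Nonempty) ∧
    ((∀ a : Fin (frobeniusNumber S + 1) → K, a 0 ≠ 0 →
        (irreduciblesWithLowCoeffs a).Infinite) →
      ∀ c : VClassGroup (AddMonoidAlgebra K S) (FractionRing (AddMonoidAlgebra K S)),
        (primeDivisorsInClass c).Infinite) := by
  refine ⟨fun h c => ?_, fun h c => ?_⟩ <;>
    obtain ⟨a, ha, hmaps⟩ := exists_mapsTo_primeDivisorsInClass hS c
  · exact ((h a ha).image _).mono hmaps.image_subset
  · have hinj : Set.InjOn (contractedSpan S) (irreduciblesWithLowCoeffs a) :=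
      fun p hp q hq =>
        injOn_contractedSpan hS ha ⟨hp.1, hp.2 0⟩ ⟨hq.1, hq.2 0⟩
    exact ((h a ha).image hinj).mono hmaps.image_subset
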